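/- Let $\ell\ge 1$ and $N\ge 0$ be integers and let $q$ be a prime power. For an integer $M\ge 0$ put $X(\ell,M)=\{x=(x_0,\dots,x_{\ell-1})\in(\mathbb Z_{\ge0})^\ell : |x|\le M\}$, where $|x|=\sum_r x_r$. For a finite sequence $m$ of nonnegative integers let $\binom{M}{m}=\frac{M!}{(M-|m|)!\,\prod_r m_r!}$ if $|m|\le M$ and $\binom{M}{m}=0$ otherwise. Let $(a)_k=a(a+1)\cdots(a+k-1)$, $(a)_0=1$, and define the Krawtchouk polynomials $$K_n(x;p;M)=\sum_{k=0}^n\frac{(-n)_k(-x)_k}{(-M)_k\,k!\,p^k}$$ and, for $n,x\in X(\ell,M)$ and $\boldsymbol p=(p_0,\dots,p_{\ell-1})$, $$K_n^{\langle\ell\rangle}(x;\boldsymbol p;M)=\frac1{(-M)_{|n|}}\prod_{r=0}^{\ell-1}(-M_r)_{n_r}K_{n_r}(x_r;p_r;M_r),\qquad M_r=M-\sum_{s<r}x_s-\sum_{s>r}n_s ,$$ the product being $0$ if $n_r>M_r$ for some $r$. Write $K_n^{\langle\ell\rangle}(x;p;M)$ if all $p_r=p$, and $x+ae_0=(x_0+a,x_1,\dots,x_{\ell-1})$.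 Let $n\in X(\ell,N)$, $0\le t\le N$, $u\in X(\ell,N)$ with $t\le u_0$, and $y\in X(\ell,t)$; if $q=2$, assume moreover $y_0=0$. Then $$K_n^{\langle\ell\rangle}\!\left(u+y-te_0;\tfrac{q-1}q;N\right)=\frac1{\binom Nn}\sum_{\alpha}\sum_{z=0}^{\alpha_0}\left(\frac{q(q-2)}{(q-1)^2}\right)^{n_0-\alpha_0}\frac1{(q-1)^{2z}}\binom{t}{n-\alpha,\,z}\binom{N-t}{\alpha-ze_0}\,K^{\langle\ell\rangle}_{\alpha-ze_0}\!\left(u-te_0;\tfrac{q-1}q;N-t\right)K^{\langle\ell\rangle}_{n-\alpha}\!\left(y;\left(\tfrac{q-2}{q-1},\tfrac{q-1}q,\dots,\tfrac{q-1}q\right);t\right),$$ where $\alpha$ runs over all elements of $X(\ell,N)$ with $\alpha_r\le n_r$ for every $r$, and $(n-\alpha,z)$ denotes the sequence $(n_0-\alpha_0,\dots,n_{\ell-1}-\alpha_{\ell-1},z)$. Here $0^0=1$, a term in which a multinomial coefficient is $0$ is read as $0$, and if $q=2$ a term with $n_0>\alpha_0$ is read as $0$ while in a term with $n_0=\alpha_0$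 the factor $K_0(y_0;0;\cdot)$ is read as $1$. -/

import Mathlib

/-- The Pochhammer symbol `(a)_k = a (a + 1) ⋯ (a + k - 1)`. -/
noncomputable def poch (a : ℝ) (k : ℕ) : ℝ := (ascPochhammer ℝ k).eval a

/-- The index set `X(ℓ, N)` of all `x = (x_0, …, x_{ℓ-1})` of natural numbers with `|x| ≤ N`.
The bound `x_r ≤ N` on the entries follows from `|x| ≤ N` and only serves to get a `Finset`. -/
def X (ℓ N : ℕ) : Finset (Fin ℓ → ℕ) :=
  (Fintype.piFinset fun _ => Finset.range (N + 1)).filter fun x => ∑ r, x r ≤ N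

theorem mem_X {ℓ N : ℕ} {x : Fin ℓ → ℕ} : x ∈ X ℓ N ↔ ∑ r, x r ≤ N := by
  simp only [X, Finset.mem_filter, Fintype.mem_piFinset, Finset.mem_range, and_iff_right_iff_imp]
  intro h r
  have := Finset.single_le_sum (f := x) (fun _ _ => Nat.zero_le _) (Finset.mem_univ r)
  omega

/-- The multinomial coefficient `N! / ((N - |m|)! ∏ m_r!)`, which is `0` if `|m| > N`. -/
noncomputable def multinom {k : ℕ} (N : ℕ) (m : Fin k → ℕ) : ℝ :=
  if ∑ r, m r ≤ N then
    (N.factorial : ℝ) / (((N - ∑ r, m r).factorial : ℝ) * ∏ r, ((m r).factorial : ℝ))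
  else 0

/-- The one-variable Krawtchouk polynomial
`K_n(x; p; N) = ∑_{k=0}^n (-n)_k (-x)_k / ((-N)_k k! p^k)`. -/
noncomputable def krawtchouk (n : ℕ) (x p N : ℝ) : ℝ :=
  ∑ k ∈ Finset.range (n + 1),
    poch (-(n : ℝ)) k * poch (-x) k / (poch (-N) k * (k.factorial : ℝ) * p ^ k)

/-- The shifted size `N_r = N - (x_0 + ⋯ + x_{r-1}) - (n_{r+1} + ⋯ + n_{ℓ-1})`, a possibly
negative integer, taken as a real number. -/
def shiftedSize {ℓ : ℕ} (n x : Fin ℓ → ℕ) (N : ℕ) (r : Fin ℓ) : ℝ :=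
  (N : ℝ) - ∑ s ∈ Finset.Iio r, (x s : ℝ) - ∑ s ∈ Finset.Ioi r, (n s : ℝ)

/-- The `ℓ`-variate Krawtchouk polynomial
`K_n^{⟨ℓ⟩}(x; p; N) = (1 / (-N)_{|n|}) ∏_r (-N_r)_{n_r} K_{n_r}(x_r; p_r; N_r)` for `n, x ∈ X(ℓ, N)`.

If `n_r > N_r` for some `r`, take the largest such `r`: there `0 ≤ N_r < n_r` and `x_r ≤ N_r`, so
that `(-N_r)_{n_r} = 0` and the product is `0`. This is also its value when each
`(-N_r)_{n_r} / (-N_r)_k` with `k ≤ n_r` is read as the polynomial `(k - N_r)_{n_r - k}`, so a zero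
denominator `(-N_r)_k` in `krawtchouk` causes no ambiguity. -/
noncomputable def mvKrawtchouk {ℓ : ℕ} (n x : Fin ℓ → ℕ) (p : Fin ℓ → ℝ) (N : ℕ) : ℝ :=
  1 / poch (-(N : ℝ)) (∑ r, n r) *
    ∏ r, (poch (-shiftedSize n x N r) (n r) *
      krawtchouk (n r) (x r : ℝ) (p r) (shiftedSize n x N r))

/-- The sequence `a e_0 = (a, 0, …, 0)`. -/
def e0 {ℓ : ℕ} [NeZero ℓ] (a : ℕ) : Fin ℓ → ℕ := Pi.single 0 a

/-! Multiplied by `multinom N n`, the polynomials have the generating function `∏_r (1 + ∑_{i<r} w_i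
+ (1 - 1/p_r) w_r)^{x_r} * (1 + ∑ w_i)^{N - |x|}` in `w`, which is multiplicative in the pair `(x,
N)`. Hence `x = (u - t e_0) + y` and `N = (N - t) + t` split it into two such products.

In the `y` factor write `1 + w_0 = (1 + c w_0) + d w_0`, where `c = 1/(q-1)^2`, `d = q(q-2)/(q-1)^2`
and `c + d = 1`. The new homogenising variable is `1 + c w_0` and the new first variable is `d w_0`.
Nothing changes for `r > 0`, while at `r = 0` the parameter `(q-1)/q` becomes `(q-2)/(q-1)`.
Expanding the powers of `1 + c w_0` produces the sum over `z`, and comparing coefficients of `w^n`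
gives the formula.

The generating function is `sum_mvKrawtchoukCoeff`, the dilation is `sum_multinom_snoc`, and
`sum_reindex` with `coeff_eq_of_sum_monomial_eq` extracts coefficients. -/

/-! ### One-variable Krawtchouk polynomials -/

theorem poch_neg_natCast (a k : ℕ) : poch (-(a : ℝ)) k = (-1) ^ k * (a.descFactorial k : ℝ) := by
  rw [poch, ascPochhammer_eval_neg_eq_descPochhammer, descPochhammer_eval_eq_descFactorial]

/-- The normalised one-variable factor, equal to `binom N n * K_n(x; p; N)` for natural `N`. -/
noncomputable def krawtchoukCoeff (n : ℕ) (x p N : ℝ) : ℝ :=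
  (-1) ^ n / (n.factorial : ℝ) * (poch (-N) n * krawtchouk n x p N)

theorem krawtchoukCoeff_eq_zero {n M : ℕ} (h : M < n) (x p : ℝ) :
    krawtchoukCoeff n x p M = 0 := by
  simp [krawtchoukCoeff, poch_neg_natCast, Nat.descFactorial_eq_zero_iff_lt.2 h]

/-- For `k ≤ n ≤ M` the denominator `(-M)_k` is nonzero and cancels through `C(M,n) C(n,k) = C(M,k)
C(M-k,n-k)`. -/
theorem krawtchoukCoeff_eq_sum {n M : ℕ} (h : n ≤ M) (x : ℕ) (p : ℝ) :
    krawtchoukCoeff n x p M = ∑ k ∈ Finset.range (n + 1),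
      (x.choose k : ℝ) * (-1 / p) ^ k * ((M - k).choose (n - k) : ℝ) := by
  rw [krawtchoukCoeff, krawtchouk, Finset.mul_sum, Finset.mul_sum]
  refine Finset.sum_congr rfl fun k hk => ?_
  have hkn : k ≤ n := Nat.lt_succ_iff.1 (Finset.mem_range.1 hk)
  have hc : (M.choose n : ℝ) * n.choose k = M.choose k * (M - k).choose (n - k) := by
    exact_mod_cast Nat.choose_mul hkn
  simp only [poch_neg_natCast, Nat.descFactorial_eq_factorial_mul_choose, Nat.cast_mul]
  have h1 : (M.choose k : ℝ) ≠ 0 := by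
    exact_mod_cast (Nat.choose_pos (hkn.trans h)).ne'
  have h2 : (k.factorial : ℝ) ≠ 0 := by exact_mod_cast k.factorial_ne_zero
  have h3 : (n.factorial : ℝ) ≠ 0 := by exact_mod_cast n.factorial_ne_zero
  have h4 : ((-1 : ℝ) ^ n) * (-1) ^ n = 1 := by rw [← mul_pow]; simp
  have h5 : ((-1 : ℝ) ^ k) ≠ 0 := by simp
  rw [div_pow]
  calc _ = ((-1 : ℝ) ^ n * (-1) ^ n) * ((M.choose n : ℝ) * n.choose k) / M.choose k *
        (x.choose k * ((-1) ^ k / p ^ k)) * ((n.factorial : ℝ) / n.factorial) *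
        ((k.factorial : ℝ) / k.factorial) * ((k.factorial : ℝ) / k.factorial) *
        ((-1) ^ k / (-1) ^ k) := by
        simp only [div_eq_mul_inv, mul_inv]; ring
    _ = _ := by
        rw [hc, h4, div_self h2, div_self h3, div_self h5]
        field_simp

/-- The generating function of the one-variable Krawtchouk polynomials. -/
theorem sum_krawtchoukCoeff {x M : ℕ} (h : x ≤ M) (p s w : ℝ) :
    ∑ n ∈ Finset.range (M + 1), krawtchoukCoeff n x p M * (s ^ (M - n) * w ^ n) =
      (s + (1 - 1 / p) * w) ^ x * (s + w) ^ (M - x) := by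
  have h1 : ∀ n ∈ Finset.range (M + 1), krawtchoukCoeff n x p M * (s ^ (M - n) * w ^ n) =
      ∑ k ∈ Finset.range (n + 1), (x.choose k : ℝ) * (-1 / p) ^ k *
        ((M - k).choose (n - k) : ℝ) * (s ^ (M - n) * w ^ n) := fun n hn => by
    rw [krawtchoukCoeff_eq_sum (Nat.lt_succ_iff.1 (Finset.mem_range.1 hn)), Finset.sum_mul]
  rw [Finset.sum_congr rfl h1]
  -- Exchange the two sums, with `j = n - k` as the new inner index; the sum over `j` is then a
  -- binomial expansion.
  rw [Finset.sum_sigma', Finset.sum_nbij' (t := (Finset.range (M + 1)).sigma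
      fun k => Finset.range (M - k + 1))
    (g := fun a => (x.choose a.1 : ℝ) * (-1 / p) ^ a.1 *
        ((M - a.1).choose a.2 : ℝ) * (s ^ (M - a.1 - a.2) * w ^ (a.1 + a.2)))
    (fun a => ⟨a.2, a.1 - a.2⟩) (fun a => ⟨a.1 + a.2, a.1⟩)]
  · rw [← Finset.sum_sigma' (Finset.range (M + 1)) (fun k => Finset.range (M - k + 1))
      (fun k j => (x.choose k : ℝ) * (-1 / p) ^ k *
        ((M - k).choose j : ℝ) * (s ^ (M - k - j) * w ^ (k + j)))]
    have h2 : ∀ k ∈ Finset.range (M + 1), ∑ j ∈ Finset.range (M - k + 1),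
        (x.choose k : ℝ) * (-1 / p) ^ k *
        ((M - k).choose j : ℝ) * (s ^ (M - k - j) * w ^ (k + j)) =
        (x.choose k : ℝ) * (-1 / p * w) ^ k * (s + w) ^ (M - k) := fun k _ => by
      rw [add_comm s w, add_pow, Finset.mul_sum]
      refine Finset.sum_congr rfl fun j _ => ?_
      rw [pow_add, mul_pow]; ring
    rw [Finset.sum_congr rfl h2]
    -- Terms with `k > x` vanish; for `k ≤ x` the exponent splits as `M - k = (x - k) + (M - x)`.
    rw [← Finset.sum_subset (Finset.range_subset_range.2 (Nat.succ_le_succ h))]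
    · rw [show s + (1 - 1 / p) * w = -1 / p * w + (s + w) by ring, add_pow, Finset.sum_mul]
      refine Finset.sum_congr rfl fun k hk => ?_
      have hk := Finset.mem_range.1 hk
      rw [show M - k = (x - k) + (M - x) by omega, pow_add]; ring
    · intro k _ hk
      rw [Nat.choose_eq_zero_of_lt (by simpa using hk)]; simp
  · rintro ⟨a, b⟩ h
    simp only [Finset.mem_sigma, Finset.mem_range] at h ⊢; omega
  · rintro ⟨a, b⟩ h
    simp only [Finset.mem_sigma, Finset.mem_range] at h ⊢; omega
  · rintro ⟨a, b⟩ h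
    simp only [Finset.mem_sigma, Finset.mem_range] at h
    have : b + (a - b) = a := by omega
    simp [this]
  · rintro ⟨a, b⟩ h
    simp
  · rintro ⟨a, b⟩ h
    simp only [Finset.mem_sigma, Finset.mem_range] at h
    have h1 : b + (a - b) = a := by omega
    have h2 : M - b - (a - b) = M - a := by omega
    simp only [h1, h2]

/-! ### The multivariate generating function, by peeling off the first coordinate -/

theorem sum_Iio_eq {ℓ : ℕ} (r : Fin ℓ) (f : Fin ℓ → ℝ) :
    ∑ s ∈ Finset.Iio r, f s = ∑ s, if s < r then f s else 0 := by
  rw [← Finset.sum_filter]; congr 1; ext; simp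

theorem sum_Ioi_eq {ℓ : ℕ} (r : Fin ℓ) (f : Fin ℓ → ℝ) :
    ∑ s ∈ Finset.Ioi r, f s = ∑ s, if r < s then f s else 0 := by
  rw [← Finset.sum_filter]; congr 1; ext; simp

theorem sum_Iio_succ {ℓ : ℕ} (r : Fin ℓ) (f : Fin (ℓ + 1) → ℝ) :
    ∑ s ∈ Finset.Iio r.succ, f s = f 0 + ∑ s ∈ Finset.Iio r, f s.succ := by
  simp [sum_Iio_eq, Fin.sum_univ_succ]

theorem shiftedSize_cons_zero {ℓ : ℕ} (k x0 : ℕ) (n x : Fin ℓ → ℕ) {N : ℕ}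
    (h : ∑ r, n r ≤ N) :
    shiftedSize (Fin.cons k n : Fin (ℓ + 1) → ℕ) (Fin.cons x0 x) N 0 =
      ((N - ∑ r, n r : ℕ) : ℝ) := by
  rw [shiftedSize, sum_Iio_eq, sum_Ioi_eq]
  simp [Fin.sum_univ_succ, Nat.cast_sub h]

theorem shiftedSize_cons_succ {ℓ : ℕ} (k x0 : ℕ) (n x : Fin ℓ → ℕ) {N : ℕ}
    (h : x0 ≤ N) (r : Fin ℓ) :
    shiftedSize (Fin.cons k n : Fin (ℓ + 1) → ℕ) (Fin.cons x0 x) N r.succ =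
      shiftedSize n x (N - x0) r := by
  simp only [shiftedSize, sum_Iio_eq, sum_Ioi_eq]
  simp [Fin.sum_univ_succ, Nat.cast_sub h]
  ring

/-- The normalised multivariate Krawtchouk polynomial `binom N n * K_n(x; p; N)`. -/
noncomputable def mvKrawtchoukCoeff {ℓ : ℕ} (n x : Fin ℓ → ℕ) (p : Fin ℓ → ℝ) (N : ℕ) : ℝ :=
  ∏ r, krawtchoukCoeff (n r) (x r) (p r) (shiftedSize n x N r)

/-- The factor at `0` sees the tail of `n` only through its sum, and the later factors see `x0` only
through `N - x0`. This recursion drives the inductions on `ℓ`. -/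
theorem mvKrawtchoukCoeff_cons {ℓ : ℕ} (k x0 : ℕ) (n x : Fin ℓ → ℕ) (p : Fin (ℓ + 1) → ℝ) {N : ℕ}
    (hn : ∑ r, n r ≤ N) (hx : x0 ≤ N) :
    mvKrawtchoukCoeff (Fin.cons k n : Fin (ℓ + 1) → ℕ) (Fin.cons x0 x) p N =
      krawtchoukCoeff k x0 (p 0) ((N - ∑ r, n r : ℕ) : ℝ) *
        mvKrawtchoukCoeff n x (Fin.tail p) (N - x0) := by
  rw [mvKrawtchoukCoeff, Fin.prod_univ_succ, shiftedSize_cons_zero _ _ _ _ hn]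
  simp only [shiftedSize_cons_succ _ _ _ _ hx]
  simp [mvKrawtchoukCoeff, Fin.tail]

/-- Either the tail of `n` fits into `N - x0`, and then its first entry is too large for its shifted
size, or the tail is itself too large and induction applies. -/
theorem mvKrawtchoukCoeff_eq_zero {ℓ : ℕ} (n x : Fin ℓ → ℕ) (p : Fin ℓ → ℝ) (N : ℕ)
    (hx : ∑ r, x r ≤ N) (hn : N < ∑ r, n r) : mvKrawtchoukCoeff n x p N = 0 := by
  induction ℓ generalizing N with
  | zero => simp at hn
  | succ ℓ ih =>
    cases n using Fin.consCases with | _ k n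
    cases x using Fin.consCases with | _ x0 x
    simp only [Fin.sum_univ_succ, Fin.cons_zero, Fin.cons_succ] at hx hn
    by_cases h : ∑ r, n r ≤ N - x0
    · rw [mvKrawtchoukCoeff_cons _ _ _ _ _ (by omega) (by omega),
        krawtchoukCoeff_eq_zero (by omega), zero_mul]
    · have := ih n x (Fin.tail p) (N - x0) (by omega) (by omega)
      rw [mvKrawtchoukCoeff] at this ⊢
      rw [Fin.prod_univ_succ]
      simp only [shiftedSize_cons_succ _ _ _ _ (show x0 ≤ N by omega)]
      simp only [Fin.tail] at this
      simp [this]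

theorem sum_X_succ {ℓ N : ℕ} (f : (Fin (ℓ + 1) → ℕ) → ℝ) :
    ∑ n ∈ X (ℓ + 1) N, f n =
      ∑ m ∈ X ℓ N, ∑ k ∈ Finset.range (N - ∑ r, m r + 1), f (Fin.cons k m) := by
  rw [Finset.sum_sigma']
  refine Finset.sum_nbij' (fun n => ⟨Fin.tail n, n 0⟩) (fun a => Fin.cons a.2 a.1) ?_ ?_ ?_ ?_ ?_
  · intro n hn
    simp only [mem_X, Finset.mem_sigma, Finset.mem_range, Fin.sum_univ_succ, Fin.tail] at hn ⊢
    omega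
  · rintro ⟨m, k⟩ hn
    simp only [mem_X, Finset.mem_sigma, Finset.mem_range, Fin.sum_univ_succ, Fin.cons_zero,
      Fin.cons_succ] at hn ⊢
    omega
  · intro n _; simp
  · intro n _; simp
  · intro n _; simp

/-- The homogenised generating function of the multivariate Krawtchouk polynomials. -/
theorem sum_mvKrawtchoukCoeff {ℓ : ℕ} (x : Fin ℓ → ℕ) (p w : Fin ℓ → ℝ) (N : ℕ) (s : ℝ)
    (hx : ∑ r, x r ≤ N) :
    ∑ n ∈ X ℓ N, mvKrawtchoukCoeff n x p N * (s ^ (N - ∑ r, n r) * ∏ r, w r ^ n r) =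
      (∏ r, (s + ∑ i ∈ Finset.Iio r, w i + (1 - 1 / p r) * w r) ^ x r) *
        (s + ∑ r, w r) ^ (N - ∑ r, x r) := by
  -- `s` must vary: summing out the first index turns the homogenising variable into `s + w 0`.
  induction ℓ generalizing N s with
  | zero =>
    have : X 0 N = {Fin.elim0} := by ext a; simp [mem_X, Subsingleton.elim a Fin.elim0]
    simp [this, mvKrawtchoukCoeff]
  | succ ℓ ih =>
    cases x using Fin.consCases with | _ x0 x
    simp only [Fin.sum_univ_succ, Fin.cons_zero, Fin.cons_succ] at hx
    rw [sum_X_succ]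
    have hsub : X ℓ (N - x0) ⊆ X ℓ N := fun m hm => by rw [mem_X] at hm ⊢; omega
    have key : ∀ m ∈ X ℓ N, ∑ k ∈ Finset.range (N - ∑ r, m r + 1),
        mvKrawtchoukCoeff (Fin.cons k m : Fin (ℓ + 1) → ℕ) (Fin.cons x0 x) p N *
          (s ^ (N - ∑ r, (Fin.cons k m : Fin (ℓ + 1) → ℕ) r) *
            ∏ r, w r ^ (Fin.cons k m : Fin (ℓ + 1) → ℕ) r) =
        mvKrawtchoukCoeff m x (Fin.tail p) (N - x0) * (∏ r, Fin.tail w r ^ m r) *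
          ∑ k ∈ Finset.range (N - ∑ r, m r + 1),
            krawtchoukCoeff k x0 (p 0) ((N - ∑ r, m r : ℕ) : ℝ) *
              (s ^ (N - ∑ r, m r - k) * w 0 ^ k) := fun m hm => by
      rw [Finset.mul_sum]
      refine Finset.sum_congr rfl fun k _ => ?_
      rw [mvKrawtchoukCoeff_cons _ _ _ _ _ (mem_X.1 hm) (by omega)]
      simp only [Fin.sum_univ_succ, Fin.prod_univ_succ, Fin.cons_zero, Fin.cons_succ, Fin.tail]
      rw [show N - (k + ∑ r, m r) = N - ∑ r, m r - k by omega]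
      ring
    -- Only tails with `|m| ≤ N - x0` contribute; for these `x0 ≤ N - |m|`, as the one-variable
    -- generating function requires.
    rw [Finset.sum_congr rfl key, ← Finset.sum_subset hsub]
    · have key2 : ∀ m ∈ X ℓ (N - x0),
          mvKrawtchoukCoeff m x (Fin.tail p) (N - x0) * (∏ r, Fin.tail w r ^ m r) *
          ∑ k ∈ Finset.range (N - ∑ r, m r + 1),
            krawtchoukCoeff k x0 (p 0) ((N - ∑ r, m r : ℕ) : ℝ) *
              (s ^ (N - ∑ r, m r - k) * w 0 ^ k) =
          (s + (1 - 1 / p 0) * w 0) ^ x0 * (mvKrawtchoukCoeff m x (Fin.tail p) (N - x0) *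
            ((s + w 0) ^ (N - x0 - ∑ r, m r) * ∏ r, Fin.tail w r ^ m r)) := fun m hm => by
        rw [mem_X] at hm
        rw [sum_krawtchoukCoeff (by omega),
          show N - ∑ r, m r - x0 = N - x0 - ∑ r, m r by omega]
        ring
      rw [Finset.sum_congr rfl key2, ← Finset.mul_sum, ih _ _ _ _ _ (by omega)]
      simp only [Fin.sum_univ_succ, Fin.prod_univ_succ, Fin.cons_zero, Fin.cons_succ, Fin.tail,
        sum_Iio_succ]
      rw [show N - (x0 + ∑ r, x r) = N - x0 - ∑ r, x r by omega]
      have : Finset.Iio (0 : Fin (ℓ + 1)) = ∅ := by ext a; simp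
      simp only [this, Finset.sum_empty, add_zero, ← add_assoc]
      ring
    · intro m _ hm
      rw [mvKrawtchoukCoeff_eq_zero _ _ _ _ (by omega) (by simpa [mem_X] using hm)]
      simp

/-! ### Multinomial normalisation and comparison of coefficients -/

theorem multinom_mul_mvKrawtchouk {ℓ : ℕ} (n x : Fin ℓ → ℕ) (p : Fin ℓ → ℝ) (N : ℕ)
    (hx : ∑ r, x r ≤ N) :
    multinom N n * mvKrawtchouk n x p N = mvKrawtchoukCoeff n x p N := by
  by_cases h : ∑ r, n r ≤ N
  · rw [multinom, if_pos h, mvKrawtchouk, mvKrawtchoukCoeff, poch_neg_natCast]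
    simp only [krawtchoukCoeff]
    rw [Finset.prod_mul_distrib (f := fun r => (-1 : ℝ) ^ n r / ((n r).factorial : ℝ)),
      Finset.prod_div_distrib, Finset.prod_pow_eq_pow_sum, ← mul_assoc]
    congr 1
    have h1 : ((N - ∑ r, n r).factorial : ℝ) * N.descFactorial (∑ r, n r) = N.factorial := by
      exact_mod_cast Nat.factorial_mul_descFactorial h
    have h2 : ((N - ∑ r, n r).factorial : ℝ) ≠ 0 := by exact_mod_cast Nat.factorial_ne_zero _
    have h3 : (N.descFactorial (∑ r, n r) : ℝ) ≠ 0 := by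
      exact_mod_cast (Nat.descFactorial_pos.2 h).ne'
    have h4 : ∏ r, ((n r).factorial : ℝ) ≠ 0 :=
      Finset.prod_ne_zero_iff.2 fun r _ => by exact_mod_cast Nat.factorial_ne_zero _
    have h5 : ((-1 : ℝ) ^ (∑ r, n r)) * (-1) ^ (∑ r, n r) = 1 := by rw [← mul_pow]; simp
    have h6 : ((-1 : ℝ) ^ (∑ r, n r)) ≠ 0 := by simp
    rw [← h1]
    generalize (-1 : ℝ) ^ (∑ r, n r) = e at *
    field_simp
    linear_combination -h5
  · rw [multinom, if_neg h, zero_mul, mvKrawtchoukCoeff_eq_zero _ _ _ _ hx (by omega)]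

theorem multinom_snoc {ℓ : ℕ} (t z : ℕ) (β : Fin ℓ → ℕ) :
    multinom t (Fin.snoc β z : Fin (ℓ + 1) → ℕ) =
      multinom t β * ((t - ∑ r, β r).choose z : ℝ) := by
  simp only [multinom, Fin.sum_univ_castSucc, Fin.prod_univ_castSucc, Fin.snoc_castSucc,
    Fin.snoc_last]
  by_cases h : ∑ r, β r + z ≤ t
  · rw [if_pos h, if_pos (by omega), Nat.cast_choose ℝ (show z ≤ t - ∑ r, β r by omega),
      show t - (∑ r, β r + z) = t - ∑ r, β r - z by omega]
    have h2 : ((t - ∑ r, β r).factorial : ℝ) ≠ 0 := by exact_mod_cast Nat.factorial_ne_zero _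
    field_simp
  · rw [if_neg h]
    by_cases h' : ∑ r, β r ≤ t
    · rw [Nat.choose_eq_zero_of_lt (by omega)]; simp
    · simp [h']

theorem multinom_ne_zero {ℓ N : ℕ} {n : Fin ℓ → ℕ} (h : ∑ r, n r ≤ N) : multinom N n ≠ 0 := by
  rw [multinom, if_pos h]
  have h4 : ∏ r, ((n r).factorial : ℝ) ≠ 0 :=
    Finset.prod_ne_zero_iff.2 fun r _ => by exact_mod_cast Nat.factorial_ne_zero _
  have := Nat.factorial_ne_zero
  simp [this, h4]

/-- Polynomials over an infinite field that agree as functions have equal coefficients. -/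
theorem coeff_eq_of_sum_monomial_eq {ℓ : ℕ} {S : Finset (Fin ℓ → ℕ)} {a b : (Fin ℓ → ℕ) → ℝ}
    (h : ∀ w : Fin ℓ → ℝ, ∑ n ∈ S, a n * ∏ r, w r ^ n r = ∑ n ∈ S, b n * ∏ r, w r ^ n r)
    {n : Fin ℓ → ℕ} (hn : n ∈ S) : a n = b n := by
  have hp : ∑ n ∈ S, MvPolynomial.monomial (Finsupp.equivFunOnFinite.symm n) (a n) =
      ∑ n ∈ S, MvPolynomial.monomial (Finsupp.equivFunOnFinite.symm n) (b n) := by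
    refine MvPolynomial.funext fun w => ?_
    simpa [map_sum, MvPolynomial.eval_monomial, Finsupp.prod_fintype] using h w
  have := congrArg (MvPolynomial.coeff (Finsupp.equivFunOnFinite.symm n)) hp
  simpa [MvPolynomial.coeff_sum, MvPolynomial.coeff_monomial, hn] using this

/-! ### Reindexing and dilation of the first variable -/

theorem sum_e0 {ℓ : ℕ} [NeZero ℓ] (z : ℕ) : ∑ r, (e0 z : Fin ℓ → ℕ) r = z := by
  simp [e0]

theorem e0_le_iff {ℓ : ℕ} [NeZero ℓ] {z : ℕ} {α : Fin ℓ → ℕ} : e0 z ≤ α ↔ z ≤ α 0 := by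
  refine ⟨fun h => by simpa [e0] using h 0, fun h r => ?_⟩
  by_cases hr : r = 0
  · subst hr; simpa [e0] using h
  · simp [e0, hr]

theorem sum_sub_e0 {ℓ : ℕ} [NeZero ℓ] {z : ℕ} {α : Fin ℓ → ℕ} (h : z ≤ α 0) :
    ∑ r, (α - e0 z : Fin ℓ → ℕ) r = ∑ r, α r - z := by
  have : ∑ r, (α - e0 z + e0 z : Fin ℓ → ℕ) r = ∑ r, α r := by rw [tsub_add_cancel_of_le (e0_le_iff.2 h)]
  simp only [Pi.add_apply (α - e0 z), Finset.sum_add_distrib, sum_e0] at this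
  omega

/-- Reindexing of a sum over `α ≤ n` and `z ≤ α_0` by `β = n - α` and `γ = α - z e_0`. -/
theorem sum_reindex {ℓ : ℕ} [NeZero ℓ] {N t : ℕ} (ht : t ≤ N)
    (F : (Fin ℓ → ℕ) → ℕ → (Fin ℓ → ℕ) → ℝ) (W : (Fin ℓ → ℕ) → ℝ)
    (hF : ∀ β z γ, F β z γ ≠ 0 → ∑ r, β r + z ≤ t ∧ ∑ r, γ r ≤ N - t) :
    ∑ n ∈ X ℓ N, (∑ α ∈ (X ℓ N).filter (fun α => ∀ r, α r ≤ n r),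
      ∑ z ∈ Finset.range (α 0 + 1), F (n - α) z (α - e0 z)) * W n =
    ∑ β ∈ X ℓ t, ∑ z ∈ Finset.range (t + 1), ∑ γ ∈ X ℓ (N - t),
      F β z γ * W (β + (γ + e0 z)) := by
  simp only [Finset.sum_mul, Finset.sum_sigma']
  symm
  -- The two index sets do not correspond as they stand; `hF` makes them match on the support of
  -- `F`.
  refine Finset.sum_bij_ne_zero
    (fun a _ _ => ⟨a.1 + (a.2.2 + e0 a.2.1), a.2.2 + e0 a.2.1, a.2.1⟩) ?_ ?_ ?_ ?_
  · rintro ⟨β, z, γ⟩ _ h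
    have := hF β z γ (left_ne_zero_of_mul h)
    simp only [Finset.mem_sigma, mem_X, Finset.mem_filter, Finset.mem_range, Pi.add_apply,
      Finset.sum_add_distrib, sum_e0]
    refine ⟨by omega, ⟨by omega, fun r => by omega⟩, ?_⟩
    simp [e0]
  · rintro ⟨β, z, γ⟩ _ _ ⟨β', z', γ'⟩ _ _ h
    simp only [Sigma.mk.injEq, heq_eq_eq] at h
    obtain ⟨h1, h2, rfl⟩ := h
    obtain rfl := add_right_cancel h2
    obtain rfl := add_right_cancel h1
    rfl
  · rintro ⟨n, α, z⟩ hm h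
    simp only [Finset.mem_sigma, mem_X, Finset.mem_filter, Finset.mem_range] at hm
    have hc := hF (n - α) z (α - e0 z) (left_ne_zero_of_mul h)
    have h1 : α - e0 z + e0 z = α := tsub_add_cancel_of_le (e0_le_iff.2 (by omega))
    have h2 : n - α + α = n := tsub_add_cancel_of_le hm.2.1.2
    refine ⟨⟨n - α, z, α - e0 z⟩, ?_, ?_, ?_⟩
    · simp only [Finset.mem_sigma, mem_X, Finset.mem_range]
      omega
    · simpa only [h1, h2] using h
    · simp only [h1, h2]
  · rintro ⟨β, z, γ⟩ _ _
    simp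

theorem prod_pow_e0 {ℓ : ℕ} [NeZero ℓ] (w : Fin ℓ → ℝ) (z : ℕ) :
    ∏ r, w r ^ (e0 z : Fin ℓ → ℕ) r = w 0 ^ z := by
  rw [Finset.prod_eq_single 0] <;> simp +contextual [e0]

theorem prod_update_zero_pow {ℓ : ℕ} [NeZero ℓ] (w : Fin ℓ → ℝ) (d : ℝ) (β : Fin ℓ → ℕ) :
    ∏ r, Function.update w 0 (d * w 0) r ^ β r = d ^ β 0 * ∏ r, w r ^ β r := by
  rw [← Finset.mul_prod_erase _ _ (Finset.mem_univ (0 : Fin ℓ)),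
    ← Finset.mul_prod_erase _ (fun r => w r ^ β r) (Finset.mem_univ (0 : Fin ℓ)),
    Finset.prod_congr rfl (g := fun r => w r ^ β r)]
  · rw [Function.update_self, mul_pow, mul_assoc]
  · intro r hr
    rw [Function.update_of_ne (Finset.ne_of_mem_erase hr)]

theorem sum_update_zero {ℓ : ℕ} [NeZero ℓ] (w : Fin ℓ → ℝ) (v : ℝ) {S : Finset (Fin ℓ)}
    (h : 0 ∈ S) : ∑ r ∈ S, Function.update w 0 v r = v - w 0 + ∑ r ∈ S, w r := by
  rw [Finset.sum_update_of_mem h, Finset.sum_eq_add_sum_sdiff_singleton_of_mem h w]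
  ring

/-- The sum over `β` and `z`, in which `z` absorbs a dilation of the homogenising variable. -/
theorem sum_multinom_snoc {ℓ : ℕ} [NeZero ℓ] (t : ℕ) (y : Fin ℓ → ℕ) (hy : ∑ r, y r ≤ t)
    (p w : Fin ℓ → ℝ) (c d : ℝ) :
    ∑ β ∈ X ℓ t, ∑ z ∈ Finset.range (t + 1), d ^ β 0 * c ^ z *
        (multinom t (Fin.snoc β z : Fin (ℓ + 1) → ℕ) * mvKrawtchouk β y p t) *
        ((∏ r, w r ^ β r) * w 0 ^ z) =
      ∑ β ∈ X ℓ t, mvKrawtchoukCoeff β y p t * ((1 + c * w 0) ^ (t - ∑ r, β r) *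
        ∏ r, Function.update w 0 (d * w 0) r ^ β r) := by
  refine Finset.sum_congr rfl fun β _ => ?_
  rw [add_comm 1, add_pow, prod_update_zero_pow, ← multinom_mul_mvKrawtchouk _ _ _ _ hy,
    Finset.sum_mul, Finset.mul_sum]
  symm
  -- The range of `z` may be extended to `t`, independently of `β`, since the added binomials
  -- vanish.
  rw [Finset.sum_subset (Finset.range_subset_range.2
    (show t - ∑ r, β r + 1 ≤ t + 1 by omega))]
  · refine Finset.sum_congr rfl fun z _ => ?_
    rw [multinom_snoc]
    simp only [one_pow, mul_pow]
    ring
  · intro z _ hz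
    rw [Nat.choose_eq_zero_of_lt (by simpa using hz)]
    simp

/-! ### The convolution identity -/

theorem mainTheorem1 (ℓ : ℕ) [NeZero ℓ] (N : ℕ) (q : ℕ) (hq : IsPrimePow q)
    (n : Fin ℓ → ℕ) (hn : n ∈ X ℓ N) (t : ℕ) (ht : t ≤ N)
    (u : Fin ℓ → ℕ) (hu : u ∈ X ℓ N) (htu : t ≤ u 0)
    (y : Fin ℓ → ℕ) (hy : y ∈ X ℓ t) (hq2 : q = 2 → y 0 = 0) :
    mvKrawtchouk n (u + y - e0 t) (fun _ => ((q : ℝ) - 1) / q) N =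
      1 / multinom N n *
        ∑ α ∈ (X ℓ N).filter (fun α => ∀ r, α r ≤ n r), ∑ z ∈ Finset.range (α 0 + 1),
          ((q : ℝ) * ((q : ℝ) - 2) / ((q : ℝ) - 1) ^ 2) ^ (n 0 - α 0) *
            (1 / ((q : ℝ) - 1) ^ (2 * z)) *
            multinom t (Fin.snoc (n - α) z : Fin (ℓ + 1) → ℕ) *
            multinom (N - t) (α - e0 z) *
            mvKrawtchouk (α - e0 z) (u - e0 t) (fun _ => ((q : ℝ) - 1) / q) (N - t) *
            mvKrawtchouk (n - α) y
              (Function.update (fun _ => ((q : ℝ) - 1) / q) 0 (((q : ℝ) - 2) / ((q : ℝ) - 1))) t := by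
  have hq2' : 2 ≤ q := hq.two_le
  rw [mem_X] at hu hy
  have hqr : (2 : ℝ) ≤ q := by exact_mod_cast hq2'
  have hq0 : (q : ℝ) ≠ 0 := by linarith
  have hq1 : (q : ℝ) - 1 ≠ 0 := by linarith
  set p : Fin ℓ → ℝ := fun _ => ((q : ℝ) - 1) / q with hp
  set p' : Fin ℓ → ℝ := Function.update p 0 (((q : ℝ) - 2) / ((q : ℝ) - 1)) with hp'
  set d : ℝ := (q : ℝ) * ((q : ℝ) - 2) / ((q : ℝ) - 1) ^ 2 with hd
  set c : ℝ := 1 / ((q : ℝ) - 1) ^ 2 with hc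
  have hcd : c + d = 1 := by rw [hc, hd]; field_simp; ring
  have hxu : u + y - e0 t = (u - e0 t) + y := by
    rw [tsub_add_eq_add_tsub (e0_le_iff.2 htu)]
  have hsu := sum_sub_e0 htu
  have hule : u 0 ≤ ∑ r, u r := Finset.single_le_sum (fun _ _ => Nat.zero_le _) (Finset.mem_univ 0)
  have hv : ∑ r, (u - e0 t : Fin ℓ → ℕ) r ≤ N - t := by omega
  set v := u - e0 t
  have hx : ∑ r, (v + y) r = ∑ r, v r + ∑ r, y r := by simp [Finset.sum_add_distrib]
  rw [hxu, one_div, eq_inv_mul_iff_mul_eq₀ (multinom_ne_zero (mem_X.1 hn)),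
    multinom_mul_mvKrawtchouk _ _ _ _ (by omega)]
  set F : (Fin ℓ → ℕ) → ℕ → (Fin ℓ → ℕ) → ℝ := fun β z γ =>
    d ^ β 0 * c ^ z * (multinom t (Fin.snoc β z : Fin (ℓ + 1) → ℕ) * mvKrawtchouk β y p' t) *
      (multinom (N - t) γ * mvKrawtchouk γ v p (N - t)) with hF
  suffices h : mvKrawtchoukCoeff n (v + y) p N =
      ∑ α ∈ (X ℓ N).filter (fun α => ∀ r, α r ≤ n r), ∑ z ∈ Finset.range (α 0 + 1),
        F (n - α) z (α - e0 z) by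
    rw [h]
    refine Finset.sum_congr rfl fun α _ => Finset.sum_congr rfl fun z _ => ?_
    simp only [hF, hc, Pi.sub_apply n α 0]
    rw [pow_mul, one_div_pow]
    ring
  refine coeff_eq_of_sum_monomial_eq (S := X ℓ N)
    (a := fun n => mvKrawtchoukCoeff n (v + y) p N)
    (b := fun n => ∑ α ∈ (X ℓ N).filter (fun α => ∀ r, α r ≤ n r),
      ∑ z ∈ Finset.range (α 0 + 1), F (n - α) z (α - e0 z)) (fun w => ?_) hn
  rw [sum_reindex ht]
  swap
  · intro β z γ h
    constructor <;> by_contra hcon <;> apply h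
    · have : multinom t (Fin.snoc β z : Fin (ℓ + 1) → ℕ) = 0 := by
        rw [multinom, if_neg]
        simpa [Fin.sum_univ_castSucc] using hcon
      simp [hF, this]
    · have : multinom (N - t) γ = 0 := by rw [multinom, if_neg hcon]
      simp [hF, this]
  have hL := sum_mvKrawtchoukCoeff (v + y) p w N 1 (by omega)
  have hU := sum_mvKrawtchoukCoeff v p w (N - t) 1 hv
  -- The homogenising variable is `1 + c * w 0`, to compensate for the dilation of `w 0` by `d`.
  have hY := sum_mvKrawtchoukCoeff y p' (Function.update w 0 (d * w 0)) t (1 + c * w 0) hy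
  rw [← sum_multinom_snoc t y hy] at hY
  simp only [one_pow, one_mul] at hL hU
  have hsplit : ∑ β ∈ X ℓ t, ∑ z ∈ Finset.range (t + 1), ∑ γ ∈ X ℓ (N - t),
      F β z γ * ∏ r, w r ^ (β + (γ + e0 z) : Fin ℓ → ℕ) r =
      (∑ β ∈ X ℓ t, ∑ z ∈ Finset.range (t + 1), d ^ β 0 * c ^ z *
        (multinom t (Fin.snoc β z : Fin (ℓ + 1) → ℕ) * mvKrawtchouk β y p' t) *
        ((∏ r, w r ^ β r) * w 0 ^ z)) *
      ∑ γ ∈ X ℓ (N - t), mvKrawtchoukCoeff γ v p (N - t) * ∏ r, w r ^ γ r := by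
    rw [Finset.sum_mul]
    refine Finset.sum_congr rfl fun β _ => ?_
    rw [Finset.sum_mul]
    refine Finset.sum_congr rfl fun z _ => ?_
    rw [Finset.mul_sum]
    refine Finset.sum_congr rfl fun γ _ => ?_
    simp only [hF, Pi.add_apply β, Pi.add_apply γ, pow_add, Finset.prod_mul_distrib, prod_pow_e0,
      multinom_mul_mvKrawtchouk γ v p (N - t) hv]
    ring
  rw [hsplit, hL, hU, hY, sum_update_zero _ _ (Finset.mem_univ _)]
  have hfac : ∀ r, (1 + c * w 0 + ∑ i ∈ Finset.Iio r, Function.update w 0 (d * w 0) i +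
      (1 - 1 / p' r) * Function.update w 0 (d * w 0) r) ^ y r =
      (1 + ∑ i ∈ Finset.Iio r, w i + (1 - 1 / p r) * w r) ^ y r := fun r => by
    by_cases hr : r = 0
    · subst hr
      by_cases h2 : q = 2
      -- Here `p' 0 = 0`, so the bases need not agree, but the exponent `y 0` is `0`.
      · simp [hq2 h2]
      · have h2' : (q : ℝ) - 2 ≠ 0 := sub_ne_zero.2 (by exact_mod_cast h2)
        have hI : Finset.Iio (0 : Fin ℓ) = ∅ := by ext a; simp
        -- Both bases equal `1 - w 0 / (q - 1)`.
        congr 1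
        simp only [hI, Finset.sum_empty, hp', hp, Function.update_self, hc, hd]
        field_simp
        ring
    -- For `r > 0` the partial sum contains index `0`, so only `c + d = 1` is needed.
    · rw [sum_update_zero _ _ (Finset.mem_Iio.2 (Fin.pos_iff_ne_zero.2 hr)), hp',
        Function.update_of_ne hr, Function.update_of_ne hr]
      congr 1
      linear_combination w 0 * hcd
  rw [Finset.prod_congr rfl fun r _ => hfac r, hx,
    show 1 + c * w 0 + (d * w 0 - w 0 + ∑ r, w r) = 1 + ∑ r, w r by linear_combination w 0 * hcd,
    show N - (∑ r, v r + ∑ r, y r) = (N - t - ∑ r, v r) + (t - ∑ r, y r) by omega, pow_add]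
  simp only [Pi.add_apply v y, pow_add, Finset.prod_mul_distrib]
  ring
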